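/- **Theorem 8.** Digraphs are pairs $G=(V(G),A(G))$ with $V(G)$ finite and non-empty and $A(G)\subseteq V(G)\times V(G)$; an arc $vw$ is *proper* if $v\neq w$, and $G^*$ is $G$ with all loops removed. A *homomorphism* $G\to H$ is a map $V(G)\to V(H)$ sending arcs to arcs; it is *strict* if it sends proper arcs to proper arcs. $\mathcal H(G,H)$ and $\mathcal S(G,H)$ are the sets of homomorphisms and of strict homomorphisms. For a class $\mathfrak D$ of digraphs, $R\sqsubseteq_{\mathcal H}S$ (resp. $R\sqsubseteq_{\mathcal S}S$) with domain $\mathfrak D$ means $\#\mathcal H(G,R)\le\#\mathcal H(G,S)$ (resp. $\#\mathcal S(G,R)\le\#\mathcal S(G,S)$) for all $G\in\mathfrak D$. Let $\mathfrak T_a$ be the class of digraphs $G$ for which $G^*$ has no closed walk of length at least $1$, and $\mathfrak P\subset\mathfrak T_a$ the class of posets (reflexive, antisymmetric, transitive digraphs). A *path* is a directed walk with distinct vertices, its length is its number of arcs; it is *maximal* if its vertex set is not properly contained in that of another path. For $vw\in A(G)$ put $[v,w]_G=\{x : vx\in A(G),\ xw\in A(G)\}$. Let $\mathrm{Tr}(G)$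 be the transitive hull of $G$. For $G\in\mathfrak T_a$, let $G_\times$ have vertex set $V(G)$ and as arcs the proper arcs $vw$ of $G$ for which $G^*$ has no walk of length at least $2$ from $v$ to $w$. The *height* $h_G$ is the largest length of a path in $G$; $V(G)^h$ is the set of vertices lying on a path of length $h_G$, and $N(G)=V(G)\setminus V(G)^h$. For $v\in N(G)$, a *bottom shell* of $v$ is a set $B\subseteq V(G)^h$ such that for every $b\in B$ there is a path in $G_\times$ from $b$ to $v$, and every path in $G_\times$ from a vertex of $V(G)^h$ to $v$ meets $B$. An *upper shell* of $v$ is a set $U\subseteq V(G)^h$ such that for every $u\in U$ there is a path in $G_\times$ from $v$ to $u$, and every path in $G_\times$ from $v$ to a vertex of $V(G)^h$ meets $U$. For $n\in\mathbb N_0$, let $\mathfrak T_a^{n,A}$ be the class of all $G\in\mathfrak T_a$ of height $n$ for which one can choose a bottom shell $B(v)$ and an upper shell $U(v)$ of every $v\in N(G)$ such that, for every connectivity component $Z$ (ignoring arc directions) of the subgraph of $G_\times$ induced on $N(G)$, there are $b_Z,u_Z\in V(G)^h$ with $$\bigcup_{z\in Z}B(z)\;\cup\;Z\;\cup\;\bigcup_{z\in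 Z}U(z)\;\subseteq\;[b_Z,u_Z]_{\mathrm{Tr}(G)} .$$ Let $\mathfrak C^{n}$ be the class of posets $R$ in which every maximal path has length $n$ and in which, for every $vw\in A(R)$, the interval $[v,w]_R$ is the vertex set of a path. Let $n\in\mathbb N_0$ and $R,S\in\mathfrak C^{n}$. If $R\sqsubseteq_{\mathcal H}S$ with domain $\mathfrak T_a$, then $R\sqsubseteq_{\mathcal S}S$ with domain $\mathfrak T_a^{n,A}$. If $R\sqsubseteq_{\mathcal H}S$ with domain $\mathfrak P$, then $R\sqsubseteq_{\mathcal S}S$ with domain $\mathfrak T_a^{n,A}\cap\mathfrak P$. -/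

import Mathlib

universe u v w

namespace Digraph

variable {V : Type u} {W : Type v}

/-- The set of homomorphisms from `G` to `H`. -/
def homs (G : Digraph V) (H : Digraph W) : Set (V → W) :=
  {f | ∀ a b, G.Adj a b → H.Adj (f a) (f b)}

/-- The digraph `G` with loops removed. -/
def noLoops (G : Digraph V) : Digraph V where
  Adj a b := G.Adj a b ∧ a ≠ b

/-- The set of strict homomorphisms: homomorphisms which map proper arcs to proper arcs. -/
def strictHoms (G : Digraph V) (H : Digraph W) : Set (V → W) :=
  homs G H ∩ homs G.noLoops H.noLoops

/-- The transitive hull. -/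
def transHull (G : Digraph V) : Digraph V where
  Adj := Relation.TransGen G.Adj

/-- No closed walk (of length at least one) exists. -/
def IsAcyclic (G : Digraph V) : Prop := ∀ a, ¬ G.transHull.Adj a a

/-- Reflexive, antisymmetric and transitive. -/
def IsPoset (G : Digraph V) : Prop :=
  (∀ a, G.Adj a a) ∧ (∀ a b, G.Adj a b → G.Adj b a → a = b) ∧
    (∀ a b c, G.Adj a b → G.Adj b c → G.Adj a c)

/-- The interval `[a, b]` of all `x` with arcs `ax` and `xb`. -/
def interval (G : Digraph V) (a b : V) : Set V := {x | G.Adj a x ∧ G.Adj x b}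

/-- A (directed) path, written as the list of its vertices. The length of a path is its number of
arcs, so a path of length `k` is a list with `k + 1` entries. -/
def IsPath (G : Digraph V) (p : List V) : Prop := p ≠ [] ∧ p.IsChain G.Adj ∧ p.Nodup

/-- A path which starts in `a` and ends in `b`. -/
def IsPathFromTo (G : Digraph V) (p : List V) (a b : V) : Prop :=
  G.IsPath p ∧ p.head? = some a ∧ p.getLast? = some b

/-- A path whose vertex set is not properly contained in the vertex set of another path. -/
def IsMaximalPath (G : Digraph V) (p : List V) : Prop :=
  G.IsPath p ∧ ∀ q, G.IsPath q → (∀ x ∈ p, x ∈ q) → ∀ x ∈ q, x ∈ p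

/-- The largest length of a path (a maximum for finite non-empty vertex sets). -/
noncomputable def height (G : Digraph V) : ℕ :=
  sSup {k | ∃ p, G.IsPath p ∧ p.length = k + 1}

/-- The set `V(G)^h` of the vertices belonging to a path of length `height G`. -/
def topVerts (G : Digraph V) : Set V :=
  {a | ∃ p, G.IsPath p ∧ p.length = G.height + 1 ∧ a ∈ p}

/-- The transitive reduction with loops removed (for digraphs which are acyclic up to loops):
the proper arcs `ab` for which there is no walk of length at least two from `a` to `b` in the
digraph with loops removed. For a poset, this is the cover relation. -/
def redStar (G : Digraph V) : Digraph V where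
  Adj a b := G.noLoops.Adj a b ∧
    ¬ ∃ c, G.noLoops.transHull.Adj a c ∧ G.noLoops.transHull.Adj c b

/-- `X` is non-empty, and any two of its vertices are connected in the subgraph induced on `X`,
regardless of the directions of the arcs. -/
def IsConnectedSet (G : Digraph V) (X : Set V) : Prop :=
  X.Nonempty ∧ ∀ a ∈ X, ∀ b ∈ X,
    Relation.ReflTransGen (fun x y => x ∈ X ∧ y ∈ X ∧ (G.Adj x y ∨ G.Adj y x)) a b

/-- `Z` is a connectivity component of the subgraph induced on `Y`. -/
def IsComponentOf (G : Digraph V) (Y Z : Set V) : Prop :=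
  Maximal (fun X => X ⊆ Y ∧ G.IsConnectedSet X) Z

/-- `B` is a bottom shell of `a`. -/
def IsBottomShell (G : Digraph V) (a : V) (B : Set V) : Prop :=
  B ⊆ G.topVerts ∧
  (∀ b ∈ B, ∃ p, G.redStar.IsPathFromTo p b a) ∧
  (∀ p, ∀ c ∈ G.topVerts, G.redStar.IsPathFromTo p c a → ∃ x ∈ p, x ∈ B)

/-- `U` is an upper shell of `a`. -/
def IsUpperShell (G : Digraph V) (a : V) (U : Set V) : Prop :=
  U ⊆ G.topVerts ∧
  (∀ b ∈ U, ∃ p, G.redStar.IsPathFromTo p a b) ∧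
  (∀ p, ∀ c ∈ G.topVerts, G.redStar.IsPathFromTo p a c → ∃ x ∈ p, x ∈ U)

/-- Every vertex off the longest paths has a bottom shell and an upper shell, and these can be
chosen such that, for every component `Z` of the transitive reduction on the vertices off the
longest paths, `Z` and all the shells of its elements are contained in a common interval of the
transitive hull whose end points are vertices on longest paths. -/
def IsEncapsulated (G : Digraph V) : Prop :=
  ∃ B U : V → Set V,
    (∀ a ∈ (G.topVerts)ᶜ, G.IsBottomShell a (B a) ∧ G.IsUpperShell a (U a)) ∧
    ∀ Z, G.redStar.IsComponentOf (G.topVerts)ᶜ Z →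
      ∃ b ∈ G.topVerts, ∃ t ∈ G.topVerts, G.transHull.Adj b t ∧
        (⋃ z ∈ Z, B z) ∪ Z ∪ (⋃ z ∈ Z, U z) ⊆ G.transHull.interval b t

end Digraph

/-- A digraph with a finite, non-empty vertex set (in the universe `u`). -/
structure FinDigraph : Type (u + 1) where
  /-- The vertices. -/
  V : Type u
  /-- The vertex set is finite. -/
  finite : Finite V
  /-- The vertex set is non-empty. -/
  nonempty : Nonempty V
  /-- The arcs. -/
  graph : Digraph V

namespace FinDigraph

/-- The class of the digraphs whose proper arcs form an acyclic digraph. -/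
def Ta : Set FinDigraph.{u} := {G | G.graph.noLoops.IsAcyclic}

/-- The class of the finite posets. -/
def Posets : Set FinDigraph.{u} := {G | G.graph.IsPoset}

/-- The class of the digraphs in `Ta` of height `n` in which the vertices off the longest paths
are encapsulated by shells. -/
def TaA (n : ℕ) : Set FinDigraph.{u} :=
  {G | G ∈ Ta ∧ G.graph.height = n ∧ G.graph.IsEncapsulated}

/-- The class of the posets in which every maximal path has length `n` and every interval is
(the vertex set of) a path. -/
def ChainPosets (n : ℕ) : Set FinDigraph.{u} :=
  {R | R ∈ Posets ∧ (∀ p, R.graph.IsMaximalPath p → p.length = n + 1) ∧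
    ∀ a b, R.graph.Adj a b → ∃ p, R.graph.IsPath p ∧ {x | x ∈ p} = R.graph.interval a b}

/-- `R ⊑_H S` with domain `D`. -/
def HomLE (R : FinDigraph.{u}) (S : FinDigraph.{v}) (D : Set FinDigraph.{w}) : Prop :=
  ∀ G ∈ D, (G.graph.homs R.graph).ncard ≤ (G.graph.homs S.graph).ncard

/-- `R ⊑_S S` with domain `D`. -/
def StrictLE (R : FinDigraph.{u}) (S : FinDigraph.{v}) (D : Set FinDigraph.{w}) : Prop :=
  ∀ G ∈ D, (G.graph.strictHoms R.graph).ncard ≤ (G.graph.strictHoms S.graph).ncard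

end FinDigraph

/-! Let `H` be one of the target posets. Its maximal chains all have `n + 1` elements, so it carries
a rank function with values in `0, …, n`. Its intervals are chains, so a point of `[x, y]` is
determined by its rank, every intermediate rank occurs, and the size is `rk y - rk x + 1`.

Put `k` new vertices on every arc of every walk of length `n` in `G` without loops, and pass to the
reflexive transitive hull, which is a poset. Its homomorphisms to `H` number `∑ f, w(f) ^ k`, where
`f` runs over the homomorphisms from `G` and `w(f)` is the product of the interval sizes along these
walks. The rank differences `d` along a walk sum to at most `n`, and `d + 1 ≤ 2 ^ d` with equality
only for `d ≤ 1`. Hence `w` has a bound common to `R` and `S`, attained exactly by the `f` sending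
each such walk to ranks `0, …, n`. Large `k` compares the numbers of these ranked homomorphisms
(`HomLE.ncard_rankedHoms_le`). Only posets serve as test objects, so both claims follow from the
hypothesis on posets.

Encapsulation makes a ranked homomorphism the same as an independent pair: its restriction to the
vertices on longest paths, and its rank pattern (`bijOn_rankedHoms`). Any other vertex is trapped in
an interval between two images already known, and its rank selects one point there. Strictness
restricts only the rank pattern, and rank patterns do not depend on `H`; so their number cancels. -/

/-! ### Rank functions from equicardinal maximal chains -/

section Rank

variable {α : Type u} [PartialOrder α]

/-- The part of a maximal chain below one of its elements and the part of another maximal chain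
above the same element form a maximal chain. -/
theorem IsMaxChain.lower_union_upper {s t : Set α} (hs : IsMaxChain (· ≤ ·) s)
    (ht : IsMaxChain (· ≤ ·) t) {a : α} (has : a ∈ s) (hat : a ∈ t) :
    IsMaxChain (· ≤ ·) ({x ∈ s | x < a} ∪ {x ∈ t | a ≤ x}) := by
  have mem_of (s : Set α) (hs : IsMaxChain (· ≤ ·) s) (z : α)
      (hz : ∀ x ∈ s, z ≤ x ∨ x ≤ z) : z ∈ s := by
    have h := hs.2 (hs.1.insert (a := z) fun x hx _ => hz x hx) (Set.subset_insert _ _)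
    rw [h]
    exact Set.mem_insert _ _
  refine ⟨?_, fun c hc hsub => hsub.antisymm fun z hz => ?_⟩
  · rintro x (⟨hx, hxa⟩ | ⟨hx, hxa⟩) y (⟨hy, hya⟩ | ⟨hy, hya⟩) hne
    · exact hs.1 hx hy hne
    · exact Or.inl (hxa.le.trans hya)
    · exact Or.inr (hya.le.trans hxa)
    · exact ht.1 hx hy hne
  · by_cases hza : a ≤ z
    · refine Or.inr ⟨mem_of t ht z fun x hx => ?_, hza⟩
      by_cases hxa : a ≤ x
      · exact hc.total hz (hsub (Or.inr ⟨hx, hxa⟩))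
      · exact Or.inr (((ht.1.total hx hat).resolve_right hxa).trans hza)
    · have hza' : z < a :=
        ((hc.total hz (hsub (Or.inr ⟨hat, le_rfl⟩))).resolve_right hza).lt_of_not_ge hza
      refine Or.inl ⟨mem_of s hs z fun x hx => ?_, hza'⟩
      by_cases hxa : x < a
      · exact hc.total hz (hsub (Or.inl ⟨hx, hxa⟩))
      · rcases hs.1.total hx has with h | h
        · obtain rfl : x = a := by
            by_contra hne
            exact hxa (lt_of_le_of_ne h hne)
          exact Or.inl hza'.le
        · exact Or.inl (hza'.le.trans h)

/-- In a finite partial order whose maximal chains have the same size, the number of elements below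
`a` in a maximal chain containing `a` does not depend on the chain. -/
theorem IsMaxChain.ncard_lower_eq [Finite α] {n : ℕ}
    (h : ∀ s : Set α, IsMaxChain (· ≤ ·) s → s.ncard = n + 1) {s t : Set α}
    (hs : IsMaxChain (· ≤ ·) s) (ht : IsMaxChain (· ≤ ·) t) {a : α} (has : a ∈ s) (hat : a ∈ t) :
    {x ∈ s | x < a}.ncard = {x ∈ t | x < a}.ncard := by
  -- The lower part of any such chain is completed to a maximal chain by one and the same upper
  -- part, that of `t`.
  have key (s : Set α) (hs : IsMaxChain (· ≤ ·) s) (has : a ∈ s) :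
      {x ∈ s | x < a}.ncard + {x ∈ t | a ≤ x}.ncard = n + 1 := by
    rw [← h _ (hs.lower_union_upper ht has hat), Set.ncard_union_eq]
    rw [Set.disjoint_left]
    rintro x ⟨-, hx⟩ ⟨-, hx'⟩
    exact hx.not_ge hx'
  have h₁ := key s hs has
  have h₂ := key t ht hat
  omega

/-- A finite partial order whose maximal chains all have `n + 1` elements has a rank function. -/
theorem exists_rank_of_ncard_maxChain [Finite α] {n : ℕ}
    (h : ∀ s : Set α, IsMaxChain (· ≤ ·) s → s.ncard = n + 1) :
    ∃ rk : α → ℕ, StrictMono rk ∧ (∀ a, rk a ≤ n) ∧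
      ∀ a b k, a ≤ b → rk a ≤ k → k ≤ rk b → ∃ x, a ≤ x ∧ x ≤ b ∧ rk x = k := by
  have hpair {a b : α} (hab : a ≤ b) :
      ∃ s : Set α, IsMaxChain (· ≤ ·) s ∧ a ∈ s ∧ b ∈ s := by
    obtain ⟨s, hs, hsub⟩ := (IsChain.pair (r := (· ≤ ·)) hab).exists_maxChain
    exact ⟨s, hs, hsub (by simp), hsub (by simp)⟩
  choose c hc hac _ using fun a : α => hpair (le_refl a)
  let rk : α → ℕ := fun a => {x ∈ c a | x < a}.ncard
  have hrk (s : Set α) (hs : IsMaxChain (· ≤ ·) s) (a : α) (has : a ∈ s) :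
      rk a = {x ∈ s | x < a}.ncard := IsMaxChain.ncard_lower_eq h (hc a) hs (hac a) has
  have hmono : StrictMono rk := by
    intro a b hab
    obtain ⟨s, hs, ha, hb⟩ := hpair hab.le
    rw [hrk s hs a ha, hrk s hs b hb]
    refine Set.ncard_lt_ncard ⟨fun x hx => ⟨hx.1, hx.2.trans hab⟩, fun hsub => ?_⟩
    exact lt_irrefl a (hsub ⟨ha, hab⟩).2
  have hle (a : α) : rk a ≤ n := by
    have : rk a < (c a).ncard :=
      Set.ncard_lt_ncard ⟨fun x hx => hx.1, fun hsub => lt_irrefl a (hsub (hac a)).2⟩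
    rw [h _ (hc a)] at this
    omega
  refine ⟨rk, hmono, hle, fun a b k hab hak hkb => ?_⟩
  obtain ⟨s, hs, ha, hb⟩ := hpair hab
  have hlt {x y : α} (hx : x ∈ s) (hy : y ∈ s) (hxy : rk x ≤ rk y) : x ≤ y := by
    by_contra hne
    have := (hs.1.total hx hy).resolve_left hne
    exact absurd (hmono (this.lt_of_not_ge hne)) (by omega)
  -- The `n + 1` elements of `s` have distinct ranks among `0, …, n`, so no rank is skipped.
  have himage : rk '' s = Set.Iic n := by
    refine Set.eq_of_subset_of_ncard_le ?_ ?_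
    · rintro _ ⟨x, -, rfl⟩
      exact hle x
    · rw [Set.InjOn.ncard_image fun x hx y hy hxy =>
        (hlt hx hy hxy.le).antisymm (hlt hy hx hxy.ge), h s hs]
      simp [Set.ncard_eq_toFinset_card']
  obtain ⟨x, hx, rfl⟩ : k ∈ rk '' s := by
    rw [himage]
    exact hkb.trans (hle b)
  exact ⟨x, hlt ha hx hak, hlt hx hb hkb, rfl⟩

end Rank

/-! ### Ranked posets with chain intervals -/

namespace Digraph

variable {V : Type u} {W : Type v}

/-- `H` is a poset in which every interval is a chain, and `rk` is a rank function on it with values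
between `0` and `n` which attains on every interval all values between those at its end points. -/
structure IsChainRanked (H : Digraph W) (n : ℕ) (rk : W → ℕ) : Prop where
  poset : H.IsPoset
  lt : ∀ a b, H.Adj a b → a ≠ b → rk a < rk b
  le : ∀ a, rk a ≤ n
  exists_rank_eq : ∀ a b k, H.Adj a b → rk a ≤ k → k ≤ rk b → ∃ x ∈ H.interval a b, rk x = k
  total : ∀ a b, ∀ x ∈ H.interval a b, ∀ y ∈ H.interval a b, H.Adj x y ∨ H.Adj y x

/-- The partial order given by a poset digraph. -/
abbrev IsPoset.toPartialOrder {H : Digraph W} (hH : H.IsPoset) : PartialOrder W where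
  le := H.Adj
  le_refl := hH.1
  le_trans := hH.2.2
  le_antisymm := hH.2.1

theorem IsPoset.isChain_of_isPath {H : Digraph W} (hH : H.IsPoset) {p : List W}
    (hp : H.IsPath p) : IsChain H.Adj {x | x ∈ p} := by
  have : IsTrans W H.Adj := ⟨hH.2.2⟩
  have hpw := List.isChain_iff_pairwise.1 hp.2.1
  have : Std.Symm fun a b => H.Adj a b ∨ H.Adj b a := ⟨fun _ _ h => h.symm⟩
  intro x hx y hy hne
  exact (hpw.imp (S := fun a b => H.Adj a b ∨ H.Adj b a) fun h => Or.inl h).forall hx hy hne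

/-- Sorting a maximal chain gives a path; any path covering it is again a chain, so maximality
carries over. -/
theorem IsPoset.ncard_maxChain [Finite W] [Nonempty W] {H : Digraph W} (hH : H.IsPoset) {n : ℕ}
    (h : ∀ p, H.IsMaximalPath p → p.length = n + 1) {s : Set W} (hs : IsMaxChain H.Adj s) :
    s.ncard = n + 1 := by
  classical
  let _ := hH.toPartialOrder
  have := Fintype.ofFinite W
  let F : Flag W := Flag.ofIsMaxChain s hs
  let q : List F := (Finset.univ : Finset F).sort
  have hmem (x : W) : x ∈ q.map Subtype.val ↔ x ∈ s := by
    simp only [List.mem_map, q, Finset.mem_sort, Finset.mem_univ, true_and]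
    exact ⟨fun ⟨y, hy⟩ => hy ▸ y.2, fun hx => ⟨⟨x, hx⟩, rfl⟩⟩
  have hne : s.Nonempty := by
    by_contra hemp
    rw [Set.not_nonempty_iff_eq_empty] at hemp
    obtain ⟨x⟩ := ‹Nonempty W›
    have := hs.2 (Set.subsingleton_singleton (a := x)).isChain (by simp [hemp])
    simp [hemp] at this
  have hpath : H.IsPath (q.map Subtype.val) := by
    refine ⟨fun h0 => ?_, ?_, ?_⟩
    · obtain ⟨x, hx⟩ := hne
      simpa [h0] using (hmem x).2 hx
    · rw [List.isChain_map]
      exact ((Finset.pairwise_sort (Finset.univ : Finset F) (· ≤ ·)).imp fun h => h).isChain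
    · exact (Finset.sort_nodup _ _).map Subtype.val_injective
  have hmax : H.IsMaximalPath (q.map Subtype.val) := by
    refine ⟨hpath, fun r hr hsub x hx => ?_⟩
    have := hs.2 (hH.isChain_of_isPath hr) fun x hx => hsub x ((hmem x).2 hx)
    rw [hmem, this]
    exact hx
  rw [← h _ hmax, List.length_map, Finset.length_sort, Finset.card_univ,
    ← Nat.card_eq_fintype_card]
  rfl

theorem exists_isChainRanked (R : FinDigraph.{u}) {n : ℕ} (hR : R ∈ FinDigraph.ChainPosets n) :
    ∃ rk, R.graph.IsChainRanked n rk := by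
  obtain ⟨hpos, hmax, hint⟩ := hR
  have := R.finite
  have := R.nonempty
  let _ := IsPoset.toPartialOrder hpos
  obtain ⟨rk, hmono, hle, hex⟩ := exists_rank_of_ncard_maxChain (n := n)
    fun s hs => IsPoset.ncard_maxChain hpos hmax hs
  refine ⟨rk, hpos, fun a b hab hne => hmono (lt_of_le_of_ne hab hne), hle,
    fun a b k hab hak hkb => ?_, fun a b x hx y hy => ?_⟩
  · obtain ⟨x, hax, hxb, hx⟩ := hex a b k hab hak hkb
    exact ⟨x, ⟨hax, hxb⟩, hx⟩
  · obtain ⟨p, hp, hpi⟩ := hint a b (hpos.2.2 _ _ _ hx.1 hx.2)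
    rw [← hpi] at hx hy
    have : Std.Refl R.graph.Adj := ⟨hpos.1⟩
    exact (IsPoset.isChain_of_isPath hpos hp).total hx hy

namespace IsChainRanked

variable {H : Digraph W} {n : ℕ} {rk : W → ℕ}

theorem mono (hH : H.IsChainRanked n rk) {a b : W} (hab : H.Adj a b) : rk a ≤ rk b := by
  by_cases h : a = b
  · rw [h]
  · exact (hH.lt a b hab h).le

theorem adj_of_le (hH : H.IsChainRanked n rk) {a b x y : W} (hx : x ∈ H.interval a b)
    (hy : y ∈ H.interval a b) (hxy : rk x ≤ rk y) : H.Adj x y := by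
  rcases hH.total a b x hx y hy with h | h
  · exact h
  · by_cases hne : y = x
    · rw [hne]
      exact hH.poset.1 x
    · exact absurd (hH.lt y x h hne) (by omega)

theorem eq_of_rank_eq (hH : H.IsChainRanked n rk) {a b x y : W} (hx : x ∈ H.interval a b)
    (hy : y ∈ H.interval a b) (hxy : rk x = rk y) : x = y :=
  hH.poset.2.1 x y (hH.adj_of_le hx hy hxy.le) (hH.adj_of_le hy hx hxy.ge)

theorem ncard_interval (hH : H.IsChainRanked n rk) {a b : W} (hab : H.Adj a b) :
    (H.interval a b).ncard = rk b - rk a + 1 := by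
  have hbij : Set.BijOn rk (H.interval a b) (Set.Icc (rk a) (rk b)) := by
    refine ⟨fun x hx => ⟨hH.mono hx.1, hH.mono hx.2⟩, fun x hx y hy hxy => ?_, fun k hk => ?_⟩
    · exact hH.eq_of_rank_eq hx hy hxy
    · obtain ⟨x, hx, hxk⟩ := hH.exists_rank_eq a b k hab hk.1 hk.2
      exact ⟨x, hx, hxk⟩
  rw [hbij.ncard_eq, Set.ncard_eq_toFinset_card']
  have := hH.mono hab
  simp
  omega

end IsChainRanked

end Digraph

/-! ### Transitive reduction and walks -/

namespace Digraph

variable {V : Type u} {W : Type v}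

/-- Count the vertices from which a given vertex is reachable. Along an arc `ab` the count gains at
least `a`, which does not reach itself. -/
theorem IsAcyclic.exists_potential [Finite V] {G : Digraph V} (hG : G.IsAcyclic) :
    ∃ φ : V → ℕ, ∀ a b, G.Adj a b → φ a < φ b := by
  refine ⟨fun a => {x | G.transHull.Adj x a}.ncard, fun a b hab => Set.ncard_lt_ncard ?_⟩
  exact ⟨fun x hx => Relation.TransGen.tail hx hab,
    fun hsub => hG a (hsub (Relation.TransGen.single hab))⟩

theorem transGen_lt_of_potential {G : Digraph V} {φ : V → ℕ}
    (hφ : ∀ a b, G.Adj a b → φ a < φ b) {a b : V} (hab : Relation.TransGen G.Adj a b) :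
    φ a < φ b := by
  induction hab with
  | single h => exact hφ _ _ h
  | tail _ h ih => exact ih.trans (hφ _ _ h)

/-- In a finite acyclic digraph, walks can be refined to walks in the transitive reduction. -/
theorem transGen_redStar_of_transGen [Finite V] {G : Digraph V} (hG : G.noLoops.IsAcyclic)
    {a b : V} (hab : Relation.TransGen G.noLoops.Adj a b) :
    Relation.TransGen G.redStar.Adj a b := by
  obtain ⟨φ, hφ⟩ := hG.exists_potential
  induction hk : φ b - φ a using Nat.strong_induction_on generalizing a b with
  | _ k ih =>
    by_cases hc : ∃ c, G.noLoops.transHull.Adj a c ∧ G.noLoops.transHull.Adj c b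
    · obtain ⟨c, hac, hcb⟩ := hc
      have h₁ := transGen_lt_of_potential hφ hac
      have h₂ := transGen_lt_of_potential hφ hcb
      exact (ih _ (by omega) hac rfl).trans (ih _ (by omega) hcb rfl)
    · refine Relation.TransGen.single ⟨?_, hc⟩
      rcases Relation.TransGen.head'_iff.1 hab with ⟨c, hac, hcb⟩
      rcases Relation.reflTransGen_iff_eq_or_transGen.1 hcb with rfl | hcb
      · exact hac
      · exact absurd ⟨c, Relation.TransGen.single hac, hcb⟩ hc

theorem IsPoset.adj_of_transGen {G : Digraph V} {H : Digraph W} (hH : H.IsPoset) {f : V → W}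
    (hf : ∀ a b, G.Adj a b → H.Adj (f a) (f b)) {a b : V} (hab : Relation.TransGen G.Adj a b) :
    H.Adj (f a) (f b) := by
  induction hab with
  | single h => exact hf _ _ h
  | tail _ h ih => exact hH.2.2 _ _ _ ih (hf _ _ h)

/-- A map into a poset is a homomorphism if it is one on the transitive reduction. -/
theorem mem_homs_of_redStar [Finite V] {G : Digraph V} (hG : G.noLoops.IsAcyclic) {H : Digraph W}
    (hH : H.IsPoset) {f : V → W} (hf : ∀ a b, G.redStar.Adj a b → H.Adj (f a) (f b)) :
    f ∈ G.homs H := by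
  intro a b hab
  by_cases hne : a = b
  · rw [hne]
    exact hH.1 _
  · exact hH.adj_of_transGen hf (transGen_redStar_of_transGen hG (.single ⟨hab, hne⟩))

/-- The walks of length `n`. -/
def walks (G : Digraph V) (n : ℕ) : Set (Fin (n + 1) → V) :=
  {p | ∀ i : Fin n, G.Adj (p i.castSucc) (p i.succ)}

theorem mem_topVerts_iff [Finite V] {G : Digraph V} (hG : G.noLoops.IsAcyclic) {n : ℕ}
    (hn : G.height = n) {a : V} :
    a ∈ G.topVerts ↔ ∃ p ∈ G.noLoops.walks n, ∃ i, p i = a := by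
  constructor
  · rintro ⟨p, ⟨-, hp, hnd⟩, hlen, ha⟩
    rw [hn] at hlen
    obtain ⟨i, hi⟩ := List.get_of_mem ha
    refine ⟨fun i => p.get (i.cast hlen.symm), fun i => ⟨?_, fun h => ?_⟩, i.cast hlen, hi⟩
    · exact List.isChain_iff_getElem.1 hp i (by omega)
    · simpa [Fin.ext_iff] using hnd.injective_get h
  · rintro ⟨p, hp, i, rfl⟩
    obtain ⟨φ, hφ⟩ := hG.exists_potential
    have hmono : StrictMono (φ ∘ p) := Fin.strictMono_iff_lt_succ.2 fun i => hφ _ _ (hp i)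
    refine ⟨List.ofFn p, ⟨by simp, ?_, List.nodup_ofFn.2 hmono.injective.of_comp⟩, by simp [hn],
      List.mem_ofFn.2 ⟨i, rfl⟩⟩
    rw [List.isChain_iff_getElem]
    intro j hj
    simp only [List.length_ofFn] at hj
    simp only [List.getElem_ofFn]
    exact (hp ⟨j, by omega⟩).1

/-! ### Components and shells -/

section Component

variable (G : Digraph V) (Y : Set V)

/-- The vertices connected to `a` in the subgraph induced on `Y`. -/
def component (a : V) : Set V :=
  {b | Relation.ReflTransGen (fun x y => x ∈ Y ∧ y ∈ Y ∧ (G.Adj x y ∨ G.Adj y x)) a b}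

variable {G Y}

theorem self_mem_component (a : V) : a ∈ G.component Y a := Relation.ReflTransGen.refl

theorem reflTransGen_induced_symm {a b : V}
    (h : Relation.ReflTransGen (fun x y => x ∈ Y ∧ y ∈ Y ∧ (G.Adj x y ∨ G.Adj y x)) a b) :
    Relation.ReflTransGen (fun x y => x ∈ Y ∧ y ∈ Y ∧ (G.Adj x y ∨ G.Adj y x)) b a := by
  have : Std.Symm fun x y => x ∈ Y ∧ y ∈ Y ∧ (G.Adj x y ∨ G.Adj y x) :=
    ⟨fun _ _ ⟨hx, hy, hxy⟩ => ⟨hy, hx, hxy.symm⟩⟩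
  exact Std.Symm.symm _ _ h

theorem component_eq_of_adj {a b : V} (ha : a ∈ Y) (hb : b ∈ Y) (hab : G.Adj a b) :
    G.component Y a = G.component Y b := by
  ext x
  exact ⟨fun h => .head ⟨hb, ha, Or.inr hab⟩ h, fun h => .head ⟨ha, hb, Or.inl hab⟩ h⟩

theorem isComponentOf_component {a : V} (ha : a ∈ Y) :
    G.IsComponentOf Y (G.component Y a) := by
  have hto {x : V} (hx : x ∈ G.component Y a) :
      Relation.ReflTransGen (fun x y => x ∈ G.component Y a ∧ y ∈ G.component Y a ∧
        (G.Adj x y ∨ G.Adj y x)) a x := by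
    induction hx with
    | refl => exact .refl
    | tail h₁ h₂ ih => exact ih.tail ⟨h₁, h₁.tail h₂, h₂.2.2⟩
  refine ⟨⟨fun x hx => ?_, ⟨a, self_mem_component a⟩, fun x hx y hy => ?_⟩,
    fun X hX hsub x hx => ?_⟩
  · rcases Relation.ReflTransGen.cases_tail hx with rfl | ⟨_, _, h⟩
    · exact ha
    · exact h.2.1
  · exact (reflTransGen_induced_symm (hto hx)).trans (hto hy)
  · exact Relation.ReflTransGen.mono (fun x y h => ⟨hX.1 h.1, hX.1 h.2.1, h.2.2⟩)
      _ _ (hX.2.2 a (hsub (self_mem_component a)) x hx)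

end Component

theorem redStar_isPathFromTo {G : Digraph V} {a b : V} (hab : G.redStar.Adj a b) :
    G.redStar.IsPathFromTo [a, b] a b :=
  ⟨⟨by simp, by simpa using hab, by simpa using hab.1.2⟩, rfl, rfl⟩

/-- The arc is a two-vertex path, so it meets `B`; it cannot do so at `a`, since shells consist of
vertices on longest paths. -/
theorem IsBottomShell.mem_of_adj {G : Digraph V} {a b : V} {B : Set V} (hB : G.IsBottomShell a B)
    (ha : a ∉ G.topVerts) (hb : b ∈ G.topVerts) (hba : G.redStar.Adj b a) : b ∈ B := by
  obtain ⟨x, hx, hxB⟩ := hB.2.2 _ b hb (redStar_isPathFromTo hba)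
  simp only [List.mem_cons, List.not_mem_nil, or_false] at hx
  rcases hx with rfl | rfl
  · exact hxB
  · exact absurd (hB.1 hxB) ha

theorem IsUpperShell.mem_of_adj {G : Digraph V} {a b : V} {U : Set V} (hU : G.IsUpperShell a U)
    (ha : a ∉ G.topVerts) (hb : b ∈ G.topVerts) (hab : G.redStar.Adj a b) : b ∈ U := by
  obtain ⟨x, hx, hxU⟩ := hU.2.2 _ b hb (redStar_isPathFromTo hab)
  simp only [List.mem_cons, List.not_mem_nil, or_false] at hx
  rcases hx with rfl | rfl
  · exact absurd (hU.1 hxU) ha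
  · exact hxU

/-- In an encapsulated digraph, every vertex `z` off the longest paths is assigned an interval
`[b z, t z]` of the transitive hull whose end points are on longest paths, which contains `z` and
all neighbours of `z` in the transitive reduction. -/
theorem IsEncapsulated.exists_bounds [Nonempty V] {G : Digraph V} (hG : G.IsEncapsulated) :
    ∃ b t : V → V, ∀ z ∉ G.topVerts, b z ∈ G.topVerts ∧ t z ∈ G.topVerts ∧
      G.transHull.Adj (b z) (t z) ∧ z ∈ G.transHull.interval (b z) (t z) ∧
      (∀ x ∈ G.topVerts, G.redStar.Adj x z ∨ G.redStar.Adj z x →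
        x ∈ G.transHull.interval (b z) (t z)) ∧
      ∀ x ∉ G.topVerts, G.redStar.Adj x z → b x = b z ∧ t x = t z := by
  obtain ⟨B, U, hBU, hcomp⟩ := hG
  choose! b hb t ht hbt hsub using hcomp
  refine ⟨fun z => b (G.redStar.component (G.topVerts)ᶜ z),
    fun z => t (G.redStar.component (G.topVerts)ᶜ z), fun z hz => ?_⟩
  have hZ := isComponentOf_component (G := G.redStar) (Y := (G.topVerts)ᶜ) hz
  have hzZ := self_mem_component (G := G.redStar) (Y := (G.topVerts)ᶜ) z
  refine ⟨hb _ hZ, ht _ hZ, hbt _ hZ, hsub _ hZ (Or.inl (Or.inr hzZ)), fun x hx hxz => ?_,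
    fun x hx hxz => ?_⟩
  · rcases hxz with hxz | hxz
    · exact hsub _ hZ (Or.inl (Or.inl (Set.mem_biUnion hzZ ((hBU z hz).1.mem_of_adj hz hx hxz))))
    · exact hsub _ hZ (Or.inr (Set.mem_biUnion hzZ ((hBU z hz).2.mem_of_adj hz hx hxz)))
  · simp only [component_eq_of_adj (G := G.redStar) (Y := (G.topVerts)ᶜ) hx hz hxz, and_self]

/-! ### Splitting homomorphisms into top part and rank pattern -/

section Levelings

variable (G : Digraph V) (H : Digraph W) (n : ℕ) (rk : W → ℕ)

/-- The homomorphisms which map the vertices of every walk of length `n` to vertices of rank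
`0, …, n`. -/
def rankedHoms : Set (V → W) :=
  {f ∈ G.homs H | ∀ p ∈ G.noLoops.walks n, ∀ i, rk (f (p i)) = i}

/-- The maps on the set of vertices on longest paths which preserve the transitive hull and map the
vertices of every walk of length `n` to vertices of rank `0, …, n`. -/
def topHoms : Set (G.topVerts → W) :=
  {g | (∀ a b : G.topVerts, G.transHull.Adj a b → H.Adj (g a) (g b)) ∧
    ∀ p ∈ G.noLoops.walks n, ∀ i, ∀ h : p i ∈ G.topVerts, rk (g ⟨p i, h⟩) = i}

/-- The monotone maps to `{0, …, n}` which number the vertices of every walk of length `n`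
consecutively. -/
def levelings : Set (V → ℕ) :=
  {ρ | (∀ a b, G.Adj a b → ρ a ≤ ρ b) ∧ (∀ a, ρ a ≤ n) ∧
    ∀ p ∈ G.noLoops.walks n, ∀ i, ρ (p i) = i}

/-- The levelings which are strictly monotone on proper arcs. -/
def strictLevelings : Set (V → ℕ) :=
  {ρ ∈ G.levelings n | ∀ a b, G.noLoops.Adj a b → ρ a < ρ b}

variable {G H n rk}

/-- A homomorphism in `rankedHoms` is determined by its restriction to the vertices on longest paths
and by the ranks of its values, and these two can be prescribed independently. -/
theorem bijOn_rankedHoms [Finite V] [Nonempty V] [Nonempty W] (hG : G.noLoops.IsAcyclic)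
    (hn : G.height = n) (henc : G.IsEncapsulated) (hH : H.IsChainRanked n rk) :
    Set.BijOn (fun f : V → W => ((fun a : G.topVerts => f a), fun a => rk (f a)))
      (G.rankedHoms H n rk) (G.topHoms H n rk ×ˢ G.levelings n) := by
  obtain ⟨b, t, hbt⟩ := henc.exists_bounds
  refine ⟨?_, ?_, ?_⟩
  · rintro f ⟨hf, hfp⟩
    exact ⟨⟨fun x y hxy => hH.poset.adj_of_transGen hf hxy, fun p hp i _ => hfp p hp i⟩,
      fun x y hxy => hH.mono (hf x y hxy), fun x => hH.le _, hfp⟩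
  · rintro f ⟨hf, -⟩ f' ⟨hf', -⟩ heq
    obtain ⟨htop, hrk⟩ := Prod.mk.inj heq
    funext z
    by_cases hz : z ∈ G.topVerts
    · exact congrFun htop ⟨z, hz⟩
    · obtain ⟨hb, ht, -, hzi, -⟩ := hbt z hz
      refine hH.eq_of_rank_eq (a := f (b z)) (b := f (t z)) ?_ ?_ (congrFun hrk z)
      · exact ⟨hH.poset.adj_of_transGen hf hzi.1, hH.poset.adj_of_transGen hf hzi.2⟩
      · rw [show f (b z) = f' (b z) from congrFun htop ⟨_, hb⟩,
          show f (t z) = f' (t z) from congrFun htop ⟨_, ht⟩]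
        exact ⟨hH.poset.adj_of_transGen hf' hzi.1, hH.poset.adj_of_transGen hf' hzi.2⟩
  · rintro ⟨g, ρ⟩ ⟨⟨hg, hgp⟩, hρ, -, hρp⟩
    dsimp only at hg hgp hρ hρp
    obtain ⟨g', hg'⟩ : ∃ g' : V → W, ∀ a : G.topVerts, g' a = g a :=
      ⟨Function.extend Subtype.val g fun _ => Classical.arbitrary W,
        Subtype.val_injective.extend_apply _ _⟩
    have hgadj {x y : V} (hx : x ∈ G.topVerts) (hy : y ∈ G.topVerts)
        (hxy : G.transHull.Adj x y) : H.Adj (g' x) (g' y) := by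
      rw [hg' ⟨x, hx⟩, hg' ⟨y, hy⟩]
      exact hg _ _ hxy
    have hgrk {x : V} (hx : x ∈ G.topVerts) : rk (g' x) = ρ x := by
      obtain ⟨p, hp, i, rfl⟩ := (mem_topVerts_iff hG hn).1 hx
      rw [hg' ⟨_, hx⟩, hgp p hp i hx, hρp p hp i]
    have hρmono {x y : V} (hxy : G.transHull.Adj x y) : ρ x ≤ ρ y := by
      induction hxy with
      | single h => exact hρ _ _ h
      | tail _ h ih => exact ih.trans (hρ _ _ h)
    -- Monotonicity of `ρ` places `ρ z` between the ranks of the two end points, so the interval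
    -- contains a point of rank `ρ z`.
    have hex (z : V) : ∃ x, (z ∈ G.topVerts → x = g' z) ∧
        (z ∉ G.topVerts → x ∈ H.interval (g' (b z)) (g' (t z))) ∧ rk x = ρ z := by
      by_cases hz : z ∈ G.topVerts
      · exact ⟨g' z, fun _ => rfl, fun h => absurd hz h, hgrk hz⟩
      · obtain ⟨hb, ht, hbtz, hzi, -⟩ := hbt z hz
        obtain ⟨x, hx, hxz⟩ := hH.exists_rank_eq (g' (b z)) (g' (t z)) (ρ z) (hgadj hb ht hbtz)
          (by rw [hgrk hb]; exact hρmono hzi.1) (by rw [hgrk ht]; exact hρmono hzi.2)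
        exact ⟨x, fun h => absurd h hz, fun _ => hx, hxz⟩
    choose f hftop hfoff hfrk using hex
    have hfi {x z : V} (hx : x ∈ G.topVerts) (hz : z ∉ G.topVerts)
        (hxz : G.redStar.Adj x z ∨ G.redStar.Adj z x) :
        f x ∈ H.interval (g' (b z)) (g' (t z)) := by
      obtain ⟨hb, ht, -, -, hnb, -⟩ := hbt z hz
      rw [hftop x hx]
      exact ⟨hgadj hb hx (hnb x hx hxz).1, hgadj hx ht (hnb x hx hxz).2⟩
    have hf : f ∈ G.homs H := by
      refine mem_homs_of_redStar hG hH.poset fun x y hxy => ?_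
      have hle : rk (f x) ≤ rk (f y) := by
        rw [hfrk, hfrk]
        exact hρ _ _ hxy.1.1
      by_cases hx : x ∈ G.topVerts <;> by_cases hy : y ∈ G.topVerts
      · rw [hftop x hx, hftop y hy]
        exact hgadj hx hy (.single hxy.1.1)
      · exact hH.adj_of_le (hfi hx hy (Or.inl hxy)) (hfoff y hy) hle
      · exact hH.adj_of_le (hfoff x hx) (hfi hy hx (Or.inr hxy)) hle
      -- Both vertices lie in one component and share its interval, where ranks decide the order.
      · obtain ⟨-, -, -, -, -, heq⟩ := hbt y hy
        have hxi := hfoff x hx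
        rw [(heq x hx hxy).1, (heq x hx hxy).2] at hxi
        exact hH.adj_of_le hxi (hfoff y hy) hle
    refine ⟨f, ⟨hf, fun p hp i => by rw [hfrk, hρp p hp i]⟩, Prod.ext ?_ (funext hfrk)⟩
    funext a
    exact (hftop a a.2).trans (hg' a)

/-- Along a walk of length `n` a strict homomorphism has `n + 1` increasing ranks in `0, …, n`,
which leaves no choice. Conversely, a strict rank inequality keeps a proper arc from collapsing. -/
theorem strictHoms_eq (hH : H.IsChainRanked n rk) :
    G.strictHoms H =
      {f ∈ G.rankedHoms H n rk | ∀ a b, G.noLoops.Adj a b → rk (f a) < rk (f b)} := by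
  ext f
  constructor
  · rintro ⟨hf, hfs⟩
    have hlt (a b : V) (hab : G.noLoops.Adj a b) : rk (f a) < rk (f b) :=
      hH.lt _ _ (hfs a b hab).1 (hfs a b hab).2
    refine ⟨⟨hf, fun p hp i => ?_⟩, hlt⟩
    let e : Fin (n + 1) → Fin (n + 1) := fun i => ⟨rk (f (p i)), Nat.lt_succ_of_le (hH.le _)⟩
    have he : StrictMono e := Fin.strictMono_iff_lt_succ.2 fun i => hlt _ _ (hp i)
    have : e i = i := by
      have := Finite.injective_iff_bijective.1 he.injective
      exact congrFun (congrArg DFunLike.coe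
        (Subsingleton.elim (he.orderIsoOfSurjective e this.2) (OrderIso.refl _))) i
    exact congrArg Fin.val this
  · rintro ⟨⟨hf, -⟩, hlt⟩
    exact ⟨hf, fun a b hab => ⟨hf a b hab.1, fun heq => (hlt a b hab).ne (congrArg rk heq)⟩⟩

theorem bijOn_strictHoms [Finite V] [Nonempty V] [Nonempty W] (hG : G.noLoops.IsAcyclic)
    (hn : G.height = n) (henc : G.IsEncapsulated) (hH : H.IsChainRanked n rk) :
    Set.BijOn (fun f : V → W => ((fun a : G.topVerts => f a), fun a => rk (f a)))
      (G.strictHoms H) (G.topHoms H n rk ×ˢ G.strictLevelings n) := by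
  have hbij := bijOn_rankedHoms hG hn henc hH
  rw [strictHoms_eq hH]
  refine ⟨fun f hf => ?_, hbij.injOn.mono fun f hf => hf.1, fun x hx => ?_⟩
  · exact ⟨(hbij.mapsTo hf.1).1, (hbij.mapsTo hf.1).2, hf.2⟩
  · obtain ⟨f, hf, rfl⟩ := hbij.surjOn ⟨hx.1, hx.2.1⟩
    exact ⟨f, ⟨hf, hx.2.2⟩, rfl⟩

end Levelings

end Digraph

/-! ### Power sums and an extremal product -/

/-- If the power sums of `x` are bounded by those of `y` and `C` is an upper bound of `y`, then `C`
occurs in `x` at most as often as in `y`. -/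
theorem card_filter_eq_le_of_sum_pow_le {ι : Type u} {κ : Type v} [Fintype ι] [Fintype κ]
    {x : ι → ℕ} {y : κ → ℕ} {C : ℕ} (hC : 0 < C) (hy : ∀ j, y j ≤ C)
    (h : ∀ k, ∑ i, x i ^ k ≤ ∑ j, y j ^ k) :
    (Finset.univ.filter fun i => x i = C).card ≤ (Finset.univ.filter fun j => y j = C).card := by
  set A := (Finset.univ.filter fun i => x i = C).card
  set B := (Finset.univ.filter fun j => y j = C).card
  set M := Fintype.card κ
  have hlow (k : ℕ) : A * C ^ k ≤ ∑ i, x i ^ k := by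
    calc A * C ^ k = ∑ i ∈ Finset.univ.filter fun i => x i = C, x i ^ k := by
          rw [Finset.sum_congr rfl fun i hi => by rw [(Finset.mem_filter.1 hi).2],
            Finset.sum_const, smul_eq_mul]
      _ ≤ ∑ i, x i ^ k := Finset.sum_le_sum_of_subset (Finset.filter_subset _ _)
  have hupp (k : ℕ) : ∑ j, y j ^ k ≤ B * C ^ k + M * (C - 1) ^ k := by
    rw [← Finset.sum_filter_add_sum_filter_not Finset.univ fun j => y j = C]
    refine add_le_add ?_ ?_
    · rw [Finset.sum_congr rfl fun i hi => by rw [(Finset.mem_filter.1 hi).2],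
        Finset.sum_const, smul_eq_mul]
    · refine (Finset.sum_le_card_nsmul _ _ ((C - 1) ^ k) fun j hj => ?_).trans ?_
      · have := hy j
        have := (Finset.mem_filter.1 hj).2
        exact Nat.pow_le_pow_left (by omega) k
      · rw [smul_eq_mul]
        exact Nat.mul_le_mul_right _ (Finset.card_le_univ _)
  by_contra hlt
  have hBA : B + 1 ≤ A := by omega
  -- A surplus copy of `C ^ k` would have to be absorbed by at most `M` terms of size at most `(C -
  -- 1) ^ k`, which fails for large `k`.
  have hCM (k : ℕ) : C ^ k ≤ M * (C - 1) ^ k := by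
    have h₁ := Nat.mul_le_mul_right (C ^ k) hBA
    have h₂ := (hlow k).trans ((h k).trans (hupp k))
    rw [add_mul, one_mul] at h₁
    omega
  have hCpos : (0 : ℝ) < C := by exact_mod_cast hC
  obtain ⟨k, hk⟩ := exists_pow_lt_of_lt_one (x := 1 / ((M : ℝ) + 1)) (y := ((C : ℝ) - 1) / C)
    (by positivity) (by rw [div_lt_one hCpos]; linarith)
  have hk' : (C : ℝ) ^ k ≤ M * ((C : ℝ) - 1) ^ k := by
    have := hCM k
    rw [← Nat.cast_le (α := ℝ)] at this
    push_cast [Nat.cast_sub (show 1 ≤ C from hC)] at this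
    exact this
  have hpow : (0 : ℝ) < (C : ℝ) ^ k := by positivity
  rw [div_pow, div_lt_div_iff₀ hpow (by positivity), one_mul] at hk
  have hC1 : (0 : ℝ) ≤ ((C : ℝ) - 1) ^ k :=
    pow_nonneg (by rw [sub_nonneg]; exact_mod_cast hC) k
  nlinarith

theorem sum_sub_eq_last_sub_zero {n : ℕ} {a : Fin (n + 1) → ℕ}
    (ha : ∀ i : Fin n, a i.castSucc ≤ a i.succ) :
    ∑ i : Fin n, (a i.succ - a i.castSucc) = a (Fin.last n) - a 0 := by
  induction n with
  | zero => simp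
  | succ n ih =>
    have h₁ := ih (a := fun i => a i.castSucc) fun i => ha i.castSucc
    have h₂ : a 0 ≤ a (Fin.last n).castSucc :=
      (Fin.monotone_iff_le_succ (f := a)).2 ha (Fin.zero_le _)
    have h₃ := ha (Fin.last n)
    rw [Fin.sum_univ_castSucc]
    simp only [Fin.castSucc_zero, Fin.succ_castSucc, Fin.succ_last, Nat.succ_eq_add_one] at *
    omega

theorem prod_succ_sub_le {n : ℕ} {a : Fin (n + 1) → ℕ}
    (ha : ∀ i : Fin n, a i.castSucc ≤ a i.succ) (hn : a (Fin.last n) ≤ n) :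
    ∏ i : Fin n, (a i.succ - a i.castSucc + 1) ≤ 2 ^ n := by
  calc ∏ i : Fin n, (a i.succ - a i.castSucc + 1)
      ≤ ∏ i : Fin n, 2 ^ (a i.succ - a i.castSucc) :=
        Finset.prod_le_prod' fun i _ => Nat.lt_two_pow_self
    _ = 2 ^ (a (Fin.last n) - a 0) := by
        rw [Finset.prod_pow_eq_pow_sum, sum_sub_eq_last_sub_zero ha]
    _ ≤ 2 ^ n := Nat.pow_le_pow_right (by norm_num) (by omega)

theorem prod_succ_sub_eq_iff {n : ℕ} {a : Fin (n + 1) → ℕ}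
    (ha : ∀ i : Fin n, a i.castSucc ≤ a i.succ) (hn : a (Fin.last n) ≤ n) :
    ∏ i : Fin n, (a i.succ - a i.castSucc + 1) = 2 ^ n ↔ ∀ i, a i = i := by
  constructor
  · intro h
    have hle (i : Fin n) : a i.succ - a i.castSucc + 1 ≤ 2 ^ (a i.succ - a i.castSucc) :=
      Nat.lt_two_pow_self
    have hsum := sum_sub_eq_last_sub_zero ha
    have hpow : ∏ i : Fin n, 2 ^ (a i.succ - a i.castSucc) = 2 ^ (a (Fin.last n) - a 0) := by
      rw [Finset.prod_pow_eq_pow_sum, hsum]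
    have hn' : n ≤ a (Fin.last n) - a 0 := by
      rw [← Nat.pow_le_pow_iff_right (a := 2) (by norm_num), ← h, ← hpow]
      exact Finset.prod_le_prod' fun i _ => hle i
    -- A step `d ≥ 2` has `d + 1 < 2 ^ d`, which would push the product strictly below `2 ^ n`.
    have hd (i : Fin n) : a i.succ - a i.castSucc ≤ 1 := by
      by_contra hi
      have hlt : ∏ i : Fin n, (a i.succ - a i.castSucc + 1) <
          ∏ i : Fin n, 2 ^ (a i.succ - a i.castSucc) := by
        refine Finset.prod_lt_prod (fun i _ => Nat.succ_pos _) (fun i _ => hle i)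
          ⟨i, Finset.mem_univ _, ?_⟩
        obtain ⟨d, hd⟩ : ∃ d, a i.succ - a i.castSucc = d + 2 :=
          ⟨a i.succ - a i.castSucc - 2, by omega⟩
        have : d < 2 ^ d := Nat.lt_two_pow_self
        rw [hd, pow_add]
        omega
      rw [h, hpow] at hlt
      have := (Nat.pow_lt_pow_iff_right (a := 2) (by norm_num)).1 hlt
      omega
    have hd1 (i : Fin n) : a i.succ - a i.castSucc = 1 := by
      refine (Finset.sum_eq_sum_iff_of_le (s := Finset.univ) (g := fun _ => 1)
        fun i _ => hd i).1 ?_ i (Finset.mem_univ i)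
      rw [hsum]
      simp
      omega
    have h0 : a 0 ≤ a (Fin.last n) :=
      (Fin.monotone_iff_le_succ (f := a)).2 ha (Fin.zero_le _)
    intro i
    induction i using Fin.induction with
    | zero => simp; omega
    | succ i ih =>
      have := hd1 i
      simp only [Fin.val_castSucc, Fin.val_succ] at *
      omega
  · intro h
    simp [h]

/-! ### Test posets with inserted vertices -/

namespace Digraph

variable {V : Type u} {W : Type v} {I : Type w}

/-- The reflexive transitive hull. -/
def reflTransHull (G : Digraph V) : Digraph V where
  Adj := Relation.ReflTransGen G.Adj

/-- This allows an acyclic test digraph to be replaced by a poset without changing the counts. -/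
theorem IsPoset.homs_reflTransHull (G : Digraph V) {H : Digraph W} (hH : H.IsPoset) :
    G.reflTransHull.homs H = G.homs H := by
  ext f
  refine ⟨fun hf a b hab => hf a b (.single hab), fun hf a b hab => ?_⟩
  rcases Relation.reflTransGen_iff_eq_or_transGen.1 hab with rfl | hab
  · exact hH.1 _
  · exact hH.adj_of_transGen hf hab

theorem isPoset_reflTransHull {G : Digraph V} {φ : V → ℕ} (hφ : ∀ a b, G.Adj a b → φ a < φ b) :
    G.reflTransHull.IsPoset := by
  refine ⟨fun a => .refl, fun a b hab hba => ?_, fun a b c hab hbc => hab.trans hbc⟩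
  rcases Relation.reflTransGen_iff_eq_or_transGen.1 hab with h | hab
  · exact h.symm
  rcases Relation.reflTransGen_iff_eq_or_transGen.1 hba with h | hba
  · exact h
  have h₁ := transGen_lt_of_potential hφ hab
  have h₂ := transGen_lt_of_potential hφ hba
  omega

/-- The digraph `G` without loops, together with new vertices `i : I` and arcs from `s i` to `i` and
from `i` to `t i`. -/
def insertBetween (G : Digraph V) (s t : I → V) : Digraph (V ⊕ I) where
  Adj
    | .inl a, .inl b => G.noLoops.Adj a b
    | .inl a, .inr i => a = s i
    | .inr i, .inl b => b = t i
    | .inr _, .inr _ => False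

theorem exists_potential_insertBetween [Finite V] {G : Digraph V} (hG : G.noLoops.IsAcyclic)
    {s t : I → V} (hst : ∀ i, G.noLoops.Adj (s i) (t i)) :
    ∃ φ : V ⊕ I → ℕ, ∀ a b, (G.insertBetween s t).Adj a b → φ a < φ b := by
  obtain ⟨φ, hφ⟩ := hG.exists_potential
  -- Doubling the old potential frees the odd values for the new vertices.
  refine ⟨Sum.elim (fun a => 2 * φ a) fun i => 2 * φ (s i) + 1, ?_⟩
  rintro (a | i) (b | j) h
  · have := hφ a b h
    simp only [Sum.elim_inl]
    omega
  · cases h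
    simp
  · cases h
    have := hφ _ _ (hst i)
    simp only [Sum.elim_inl, Sum.elim_inr]
    omega
  · exact h.elim

/-- A homomorphism from `G.insertBetween s t` to a reflexive digraph consists of a homomorphism `f`
on `G` and an element of the interval `[f (s i), f (t i)]` for every new vertex `i`. -/
def homsInsertBetweenEquiv (G : Digraph V) {H : Digraph W} (hH : ∀ a, H.Adj a a) (s t : I → V) :
    (G.insertBetween s t).homs H ≃
      Σ f : G.homs H, ∀ i, H.interval (f.1 (s i)) (f.1 (t i)) where
  toFun F := ⟨⟨fun a => F.1 (.inl a), fun a b hab => by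
      by_cases h : a = b
      · rw [h]
        exact hH _
      · exact F.2 (.inl a) (.inl b) ⟨hab, h⟩⟩,
    fun i => ⟨F.1 (.inr i), F.2 (.inl (s i)) (.inr i) rfl, F.2 (.inr i) (.inl (t i)) rfl⟩⟩
  invFun x := ⟨Sum.elim x.1.1 fun i => (x.2 i).1, by
    rintro (a | i) (b | j) h
    · exact x.1.2 a b h.1
    · cases h
      exact (x.2 j).2.1
    · cases h
      exact (x.2 i).2.2
    · exact h.elim⟩
  left_inv F := by
    ext (a | i) <;> rfl
  right_inv x := rfl

theorem ncard_homs_insertBetween [Finite V] [Finite W] [Fintype I] (G : Digraph V) {H : Digraph W}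
    [Fintype (G.homs H)] (hH : ∀ a, H.Adj a a) (s t : I → V) :
    ((G.insertBetween s t).homs H).ncard =
      ∑ f : G.homs H, ∏ i, (H.interval (f.1 (s i)) (f.1 (t i))).ncard := by
  rw [← Nat.card_coe_set_eq, Nat.card_congr (G.homsInsertBetweenEquiv hH s t), Nat.card_sigma]
  simp only [Nat.card_pi, Nat.card_coe_set_eq]

/-! ### Walk weights and their maximizers -/

section Weight

variable (G : Digraph V) (H : Digraph W) (n : ℕ)

/-- The product of the sizes of the intervals between the images of consecutive vertices of the
walks of length `n`. -/
noncomputable def walkWeight [Fintype (G.noLoops.walks n)] (f : V → W) : ℕ :=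
  ∏ q : G.noLoops.walks n × Fin n, (H.interval (f (q.1.1 q.2.castSucc)) (f (q.1.1 q.2.succ))).ncard

variable {G H n} {rk : W → ℕ} [Fintype (G.noLoops.walks n)]

theorem IsChainRanked.walkWeight_eq (hH : H.IsChainRanked n rk) {f : V → W} (hf : f ∈ G.homs H) :
    G.walkWeight H n f = ∏ p : G.noLoops.walks n, ∏ i : Fin n,
      (rk (f (p.1 i.succ)) - rk (f (p.1 i.castSucc)) + 1) := by
  rw [walkWeight, Fintype.prod_prod_type]
  exact Finset.prod_congr rfl fun p _ => Finset.prod_congr rfl fun i _ =>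
    hH.ncard_interval (hf _ _ (p.2 i).1)

theorem IsChainRanked.walkWeight_le (hH : H.IsChainRanked n rk) {f : V → W} (hf : f ∈ G.homs H) :
    G.walkWeight H n f ≤ (2 ^ n) ^ Fintype.card (G.noLoops.walks n) := by
  rw [hH.walkWeight_eq hf, ← Finset.card_univ]
  exact Finset.prod_le_pow_card _ _ _ fun p _ =>
    prod_succ_sub_le (a := fun i => rk (f (p.1 i))) (fun i => hH.mono (hf _ _ (p.2 i).1)) (hH.le _)

theorem IsChainRanked.walkWeight_eq_iff (hH : H.IsChainRanked n rk) {f : V → W}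
    (hf : f ∈ G.homs H) :
    G.walkWeight H n f = (2 ^ n) ^ Fintype.card (G.noLoops.walks n) ↔
      f ∈ G.rankedHoms H n rk := by
  have hmono (p : G.noLoops.walks n) (i : Fin n) :
      rk (f (p.1 i.castSucc)) ≤ rk (f (p.1 i.succ)) := hH.mono (hf _ _ (p.2 i).1)
  have hiff (p : G.noLoops.walks n) :=
    prod_succ_sub_eq_iff (a := fun i => rk (f (p.1 i))) (hmono p) (hH.le _)
  rw [hH.walkWeight_eq hf, ← Finset.card_univ]
  constructor
  · refine fun h => ⟨hf, fun p hp => (hiff ⟨p, hp⟩).1 ?_⟩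
    by_contra hne
    refine h.not_lt ?_
    rw [← Finset.prod_const]
    exact Finset.prod_lt_prod (fun p _ => Finset.prod_pos fun i _ => Nat.succ_pos _)
      (fun p _ => prod_succ_sub_le (a := fun i => rk (f (p.1 i))) (hmono p) (hH.le _))
      ⟨⟨p, hp⟩, Finset.mem_univ _, lt_of_le_of_ne
        (prod_succ_sub_le (a := fun i => rk (f (p i))) (hmono ⟨p, hp⟩) (hH.le _)) hne⟩
  · exact fun h => Finset.prod_eq_pow_card fun p _ => (hiff p).2 (h.2 p.1 p.2)

theorem IsChainRanked.ncard_rankedHoms [Fintype (G.homs H)] (hH : H.IsChainRanked n rk) :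
    (G.rankedHoms H n rk).ncard = (Finset.univ.filter fun f : G.homs H =>
      G.walkWeight H n f.1 = (2 ^ n) ^ Fintype.card (G.noLoops.walks n)).card := by
  rw [← Set.ncard_coe_finset, ← Set.ncard_image_of_injective _ Subtype.val_injective]
  congr 1
  ext f
  simp only [Finset.coe_filter, Finset.mem_univ, true_and, Set.mem_image, Set.mem_ofPred_eq,
    Subtype.exists, exists_and_right, exists_eq_right]
  exact ⟨fun h => ⟨h.1, (hH.walkWeight_eq_iff h.1).2 h⟩, fun ⟨hf, h⟩ =>
    (hH.walkWeight_eq_iff hf).1 h⟩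

/-- The `k` vertices on an arc choose their images independently, so each interval size enters to
the power `k`. -/
theorem ncard_homs_insertBetween_walks [Finite V] [Finite W] [Fintype (G.homs H)]
    (hH : ∀ a, H.Adj a a) (k : ℕ) :
    ((G.insertBetween
      (fun q : (G.noLoops.walks n × Fin n) × Fin k => q.1.1.1 q.1.2.castSucc)
      (fun q => q.1.1.1 q.1.2.succ)).homs H).ncard =
      ∑ f : G.homs H, G.walkWeight H n f.1 ^ k := by
  rw [ncard_homs_insertBetween G hH]
  refine Finset.sum_congr rfl fun f _ => ?_
  rw [Fintype.prod_prod_type, walkWeight, ← Finset.prod_pow]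
  simp

end Weight

end Digraph

/-! ### Comparison of `R` and `S` -/

namespace FinDigraph

open Digraph

theorem HomLE.ncard_rankedHoms_le {R : FinDigraph.{u}} {S : FinDigraph.{v}} {n : ℕ}
    {rkR : R.V → ℕ} {rkS : S.V → ℕ} (hR : R.graph.IsChainRanked n rkR)
    (hS : S.graph.IsChainRanked n rkS) (h : HomLE R S Posets.{w}) {G : FinDigraph.{w}}
    (hG : G ∈ Ta) :
    (G.graph.rankedHoms R.graph n rkR).ncard ≤ (G.graph.rankedHoms S.graph n rkS).ncard := by
  have := G.finite
  have := G.nonempty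
  have := R.finite
  have := S.finite
  have := Fintype.ofFinite (G.graph.noLoops.walks n)
  have := Fintype.ofFinite (G.graph.homs R.graph)
  have := Fintype.ofFinite (G.graph.homs S.graph)
  rw [hR.ncard_rankedHoms, hS.ncard_rankedHoms]
  refine card_filter_eq_le_of_sum_pow_le (by positivity) (fun f => hS.walkWeight_le f.2)
    fun k => ?_
  rw [← ncard_homs_insertBetween_walks hR.poset.1, ← ncard_homs_insertBetween_walks hS.poset.1]
  obtain ⟨φ, hφ⟩ := exists_potential_insertBetween hG
    (s := fun q : (G.graph.noLoops.walks n × Fin n) × Fin k => q.1.1.1 q.1.2.castSucc)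
    (t := fun q => q.1.1.1 q.1.2.succ) fun q => q.1.1.2 q.1.2
  rw [← hR.poset.homs_reflTransHull, ← hS.poset.homs_reflTransHull]
  exact h ⟨_, inferInstance, inferInstance, _⟩ (isPoset_reflTransHull hφ)

theorem HomLE.strictLE_taA {n : ℕ} {R : FinDigraph.{u}} {S : FinDigraph.{v}}
    (hR : R ∈ ChainPosets n) (hS : S ∈ ChainPosets n) (h : HomLE R S Posets.{w}) :
    StrictLE R S (TaA.{w} n) := by
  rintro G ⟨hG, hn, henc⟩
  have := G.finite
  have := G.nonempty
  have := R.nonempty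
  have := S.nonempty
  obtain ⟨rkR, hrkR⟩ := exists_isChainRanked R hR
  obtain ⟨rkS, hrkS⟩ := exists_isChainRanked S hS
  have hle := h.ncard_rankedHoms_le hrkR hrkS hG
  rw [(bijOn_rankedHoms hG hn henc hrkR).ncard_eq, (bijOn_rankedHoms hG hn henc hrkS).ncard_eq,
    Set.ncard_prod, Set.ncard_prod] at hle
  rw [(bijOn_strictHoms hG hn henc hrkR).ncard_eq, (bijOn_strictHoms hG hn henc hrkS).ncard_eq,
    Set.ncard_prod, Set.ncard_prod]
  rcases Nat.eq_zero_or_pos (G.graph.strictLevelings n).ncard with h0 | hpos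
  · simp [h0]
  -- Strict levelings are levelings, so the common factor in `hle` is positive and cancels;
  -- finiteness is needed for `ncard` to be monotone.
  · have hfin : (G.graph.levelings n).Finite :=
      (Set.Finite.pi' fun _ : G.V => Set.finite_Iic n).subset fun ρ hρ a => hρ.2.1 a
    exact Nat.mul_le_mul_right _ (Nat.le_of_mul_le_mul_right hle
      (hpos.trans_le (Set.ncard_le_ncard (fun ρ hρ => hρ.1) hfin)))

theorem posets_subset_ta : Posets.{u} ⊆ Ta := by
  intro G hG a ha
  have key {x y : G.V} (h : Relation.TransGen G.graph.noLoops.Adj x y) :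
      G.graph.Adj x y ∧ x ≠ y := by
    induction h with
    | single h => exact h
    | tail _ h ih =>
      refine ⟨hG.2.2 _ _ _ ih.1 h.1, ?_⟩
      rintro rfl
      exact ih.2 (hG.2.1 _ _ ih.1 h.1)
  exact (key ha).2 rfl

end FinDigraph

theorem theorem8 (n : ℕ) (R : FinDigraph.{u}) (S : FinDigraph.{v})
    (hR : R ∈ FinDigraph.ChainPosets n) (hS : S ∈ FinDigraph.ChainPosets n) :
    (FinDigraph.HomLE R S FinDigraph.Ta.{w} →
      FinDigraph.StrictLE R S (FinDigraph.TaA.{w} n)) ∧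
    (FinDigraph.HomLE R S FinDigraph.Posets.{w} →
      FinDigraph.StrictLE R S (FinDigraph.TaA.{w} n ∩ FinDigraph.Posets.{w})) := by
  refine ⟨fun h => ?_, fun h G hG => h.strictLE_taA hR hS G hG.1⟩
  have h' : FinDigraph.HomLE R S FinDigraph.Posets.{w} :=
    fun G hG => h G (FinDigraph.posets_subset_ta hG)
  exact h'.strictLE_taA hR hS
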